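/- Consider a two-tier network of base stations (BSs) with tiers $j\in\{m,s\}$ (macro cells, small cells) and a user at the origin of $\mathbb R^2$. Let $\alpha>2$ be the path-loss exponent of both tiers and let tier $j$ have density $\lambda_j>0$, transmit power per user $p_j>0$, number of served users $\Psi_j\ge 1$, number of antennas $M_j\ge\Psi_j$ and cell bias $B_j>0$; put $\Delta_j=M_j-\Psi_j+1$, $\hat p_s=p_s/p_m$, $\hat\Delta_s=\Delta_s/\Delta_m$, $\hat B_s=B_s/B_m$. The positions of the BSs of the two tiers form independent homogeneous Poisson point processes $\Phi_m,\Phi_s$ in $\mathbb R^2$ of densities $\lambda_m,\lambda_s$, and the interfering power gains $g_{y,j}\sim\Gamma(\Psi_j,1)$ (shape $\Psi_j$, scale $1$), $y\in\Phi_j$, are mutually independent and independent of the positions. Suppose the user is served by a BS at distance $r>0$. The interferers of tier $j$ are the points of $\Phi_j$ outside the ball of radius $r_j$ about the origin, where - if the user is associated with a macro BS, $r_m=r$ and $r_s=(\hat p_s\hat\Delta_s\hat B_s\,r^{\alpha})^{1/\alpha}$; - if the user is associated with a small-cell BS, $r_s=r$ and $r_m=\big(1/(\hat p_s\hat\Delta_s\hat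 B_s\,r^{-\alpha})\big)^{1/\alpha}$. Let $$I=\sum_{j\in\{m,s\}}\ \sum_{y\in\Phi_j,\ \|y\|>r_j}p_j\,g_{y,j}\,\|y\|^{-\alpha}.$$ Then, in both cases, the series converge almost surely, and for every $s\ge 0$ the Laplace transform $\mathcal L_I(s)=\mathbb E[e^{-sI}]$ is $$\mathcal L_I(s)=\exp\Big\{-s^{2/\alpha}\sum_{j\in\{m,s\}}\lambda_j\,p_j^{2/\alpha}\,\mathcal C(\alpha,\Psi_j,w_j)\Big\},$$ where $$\mathcal C(\alpha,\Psi,w)=\frac{2\pi}{\alpha}\sum_{i=1}^{\Psi}\binom{\Psi}{i}\,B'\Big(\Psi-i+\frac2\alpha,\ i-\frac2\alpha,\ w\Big),\qquad B'(a,b,x)=\int_x^1t^{a-1}(1-t)^{b-1}\,dt,$$ and - if the user is associated with a macro BS, $w_m=\dfrac1{1+s\,p_m\,r^{-\alpha}}$ and $w_s=\dfrac1{1+s\,p_s\,\eta}$ with $\eta=\dfrac1{\hat p_s\hat\Delta_s\hat B_s\,r^{\alpha}}$; - if the user is associated with a small-cell BS, $w_m=\dfrac1{1+s\,p_m\,\eta^{-1}}$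 with $\eta=\dfrac1{\hat p_s\hat\Delta_s\hat B_s\,r^{-\alpha}}$, and $w_s=\dfrac1{1+s\,p_s\,r^{-\alpha}}$. -/

import Mathlib

open MeasureTheory ProbabilityTheory

noncomputable section

namespace HetNet

/-- The Euclidean plane. -/
abbrev Plane : Type := EuclideanSpace ℝ (Fin 2)

/-- The two tiers of base stations (BSs): macro cells (`mbs`) and small cells (`sbs`). -/
inductive Tier : Type
  | mbs
  | sbs

/-- The parameters of a two-tier multi-antenna network: common path-loss exponent `α > 2` and, for
each tier, density `lam`, transmit power per user `p`, number of antennas `M`, number of served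
users `Ψ` and cell bias `B`. -/
structure Network where
  α : ℝ
  lam : Tier → ℝ
  p : Tier → ℝ
  M : Tier → ℕ
  Ψ : Tier → ℕ
  B : Tier → ℝ
  two_lt_α : 2 < α
  lam_pos : ∀ j, 0 < lam j
  p_pos : ∀ j, 0 < p j
  Ψ_pos : ∀ j, 0 < Ψ j
  Ψ_le_M : ∀ j, Ψ j ≤ M j
  B_pos : ∀ j, 0 < B j

namespace Network

/-- `Δ_j = M_j - Ψ_j + 1`, the shape parameter of the gain of the direct links. -/
def Δ (N : Network) (j : Tier) : ℝ := (N.M j : ℝ) - (N.Ψ j : ℝ) + 1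

/-- The product `p̂_s Δ̂_s B̂_s` of the ratios `p_s / p_m`, `Δ_s / Δ_m`, `B_s / B_m`. -/
def biasRatio (N : Network) : ℝ :=
  (N.p .sbs / N.p .mbs) * (N.Δ .sbs / N.Δ .mbs) * (N.B .sbs / N.B .mbs)

/-- The biased mean received power `B_j Δ_j p_j ρ^{-α}` from a BS of tier `j` at distance `ρ`. -/
def biasedPower (N : Network) (j : Tier) (ρ : ℝ) : ℝ := N.B j * N.Δ j * N.p j * ρ ^ (-N.α)

/-- `N.exclusionRadius k r j`: when the user at the origin is served by a BS of tier `k` at distance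
`r`, the interfering BSs of tier `j` lie outside the ball of this radius about the origin. -/
def exclusionRadius (N : Network) (k : Tier) (r : ℝ) (j : Tier) : ℝ :=
  match k, j with
  | .mbs, .mbs => r
  | .mbs, .sbs => (N.biasRatio * r ^ N.α) ^ (1 / N.α)
  | .sbs, .mbs => (1 / (N.biasRatio * r ^ (-N.α))) ^ (1 / N.α)
  | .sbs, .sbs => r

lemma Δ_pos (N : Network) (j : Tier) : 0 < N.Δ j := by
  have h : (N.Ψ j : ℝ) ≤ N.M j := by exact_mod_cast N.Ψ_le_M j
  unfold Δ
  linarith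

lemma biasRatio_pos (N : Network) : 0 < N.biasRatio := by
  unfold biasRatio
  have h1 := N.Δ_pos .sbs; have h2 := N.Δ_pos .mbs
  have h3 := N.p_pos .sbs; have h4 := N.p_pos .mbs
  have h5 := N.B_pos .sbs; have h6 := N.B_pos .mbs
  positivity

/-- The exclusion radius is the one dictated by the selection of the BS with the largest biased
mean received power: the BSs of tier `j` outside the ball are those that are weaker, in this sense,
than the serving BS. -/
lemma exclusionRadius_lt_iff (N : Network) (k j : Tier) {r ρ : ℝ} (hr : 0 < r) (hρ : 0 < ρ) :
    N.exclusionRadius k r j < ρ ↔ N.biasedPower j ρ < N.biasedPower k r := by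
  have h1 := N.Δ_pos .sbs; have h2 := N.Δ_pos .mbs
  have h3 := N.p_pos .sbs; have h4 := N.p_pos .mbs
  have h5 := N.B_pos .sbs; have h6 := N.B_pos .mbs
  have hb := N.biasRatio_pos
  have hα : 0 < N.α := by linarith [N.two_lt_α]
  have hrα : 0 < r ^ N.α := Real.rpow_pos_of_pos hr _
  have hρα : 0 < ρ ^ N.α := Real.rpow_pos_of_pos hρ _
  have key : ∀ x : ℝ, 0 < x → (x ^ (1 / N.α) < ρ ↔ x < ρ ^ N.α) := fun x hx => by
    rw [one_div, Real.rpow_inv_lt_iff_of_pos hx.le hρ.le hα]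
  have key2 : r < ρ ↔ r ^ N.α < ρ ^ N.α := (Real.rpow_lt_rpow_iff hr.le hρ.le hα).symm
  cases k <;> cases j <;> simp only [exclusionRadius, biasedPower]
  · rw [key2, Real.rpow_neg hr.le, Real.rpow_neg hρ.le, mul_lt_mul_iff_right₀ (by positivity),
      inv_lt_inv₀ hρα hrα]
  · rw [key _ (by positivity), biasRatio, Real.rpow_neg hr.le, Real.rpow_neg hρ.le]
    field_simp
  · rw [key _ (by positivity), biasRatio, Real.rpow_neg hr.le, Real.rpow_neg hρ.le]
    field_simp
  · rw [key2, Real.rpow_neg hr.le, Real.rpow_neg hρ.le, mul_lt_mul_iff_right₀ (by positivity),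
      inv_lt_inv₀ hρα hrα]

/-- `N.w k s r j`: the lower limit `w_j` of the incomplete Beta functions for tier `j`, when the
user is served by a BS of tier `k` at distance `r`. -/
def w (N : Network) (k : Tier) (s r : ℝ) (j : Tier) : ℝ :=
  match k with
  | .mbs =>
    let η := 1 / (N.biasRatio * r ^ N.α)
    match j with
    | .mbs => 1 / (1 + s * N.p .mbs * r ^ (-N.α))
    | .sbs => 1 / (1 + s * N.p .sbs * η)
  | .sbs =>
    let η := 1 / (N.biasRatio * r ^ (-N.α))
    match j with
    | .mbs => 1 / (1 + s * N.p .mbs * η⁻¹)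
    | .sbs => 1 / (1 + s * N.p .sbs * r ^ (-N.α))

end Network

/-- The complementary incomplete Beta function `B'(a, b, x) = ∫_x^1 t^(a-1) (1-t)^(b-1) dt`. -/
def compBeta (a b x : ℝ) : ℝ := ∫ t in x..1, t ^ (a - 1) * (1 - t) ^ (b - 1)

/-- `𝒞(α, Ψ, w) = (2π/α) ∑_{i=1}^Ψ binom(Ψ, i) B'(Ψ - i + 2/α, i - 2/α, w)`. -/
def coeffC (α : ℝ) (Ψ : ℕ) (w : ℝ) : ℝ :=
  2 * Real.pi / α * ∑ i ∈ Finset.Icc 1 Ψ,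
    (Ψ.choose i : ℝ) * compBeta ((Ψ : ℝ) - (i : ℝ) + 2 / α) ((i : ℝ) - 2 / α) w

section Model

variable {Ω : Type*} [MeasurableSpace Ω]

/-- The number of points of the sequence `x 0 ω, x 1 ω, …` that lie in `A`. -/
def count (x : ℕ → Ω → Plane) (A : Set Plane) (ω : Ω) : ENNReal :=
  ∑' n, A.indicator (fun _ => (1 : ENNReal)) (x n ω)

/-- The random points `x 0, x 1, …` enumerate a homogeneous Poisson point process (PPP) of density
`lam` in the plane: counts in sets of finite area are Poisson distributed with mean `lam * area`,
and counts in disjoint sets are independent. -/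
structure IsHomogeneousPPP (x : ℕ → Ω → Plane) (lam : ℝ) (P : Measure Ω) : Prop where
  measurable : ∀ n, Measurable (x n)
  hasLaw_count : ∀ A : Set Plane, MeasurableSet A → volume A ≠ ⊤ →
    HasLaw (count x A)
      ((poissonMeasure (lam * (volume A).toReal).toNNReal).map (fun n : ℕ => (n : ENNReal))) P
  indep_count : ∀ (n : ℕ) (A : Fin n → Set Plane), (∀ i, MeasurableSet (A i)) →
    (∀ i, volume (A i) ≠ ⊤) → Pairwise (fun i j => Disjoint (A i) (A j)) →
    iIndepFun (fun i => count x (A i)) P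

/-- The probabilistic model: `x j n` is the position of the `n`-th BS of tier `j` and `g j n` the
power gain of its link to the user at the origin. The two tiers form independent homogeneous PPPs of
densities `lam j`; the gains are mutually independent, independent of all the positions, and
`g j n` has the Gamma distribution with shape `Ψ j` and scale `1`. -/
structure IsModel (N : Network) (x : Tier → ℕ → Ω → Plane) (g : Tier → ℕ → Ω → ℝ)
    (P : Measure Ω) : Prop where
  ppp : ∀ j, IsHomogeneousPPP (x j) (N.lam j) P
  indep_tiers : IndepFun (fun ω n => x .mbs n ω) (fun ω n => x .sbs n ω) P
  measurable_gain : ∀ j n, Measurable (g j n)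
  hasLaw_gain : ∀ j n, HasLaw (g j n) (gammaMeasure (N.Ψ j) 1) P
  indep_gains : iIndepFun (fun (a : Tier × ℕ) ω => g a.1 a.2 ω) P
  indep_positions_gains :
    IndepFun (fun ω (a : Tier × ℕ) => x a.1 a.2 ω) (fun ω (a : Tier × ℕ) => g a.1 a.2 ω) P

/-- The power `p_j g ‖y‖^{-α}` received from the `n`-th BS of tier `j`, at position `y`, if that BS
lies outside the exclusion ball, and `0` otherwise. -/
def interferenceTerm (N : Network) (x : Tier → ℕ → Ω → Plane) (g : Tier → ℕ → Ω → ℝ)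
    (k : Tier) (r : ℝ) (j : Tier) (n : ℕ) (ω : Ω) : ℝ :=
  {y : Plane | N.exclusionRadius k r j < ‖y‖}.indicator
    (fun y => N.p j * g j n ω * ‖y‖ ^ (-N.α)) (x j n ω)

/-- The aggregate interference from both tiers at the user at the origin, served by a BS of tier `k`
at distance `r`. -/
def interference (N : Network) (x : Tier → ℕ → Ω → Plane) (g : Tier → ℕ → Ω → ℝ)
    (k : Tier) (r : ℝ) (ω : Ω) : ℝ :=
  (∑' n, interferenceTerm N x g k r .mbs n ω) + ∑' n, interferenceTerm N x g k r .sbs n ω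

/-- The Laplace transform `E[exp(-s X)]` of a random variable `X`. -/
def laplaceTransform (P : Measure Ω) (X : Ω → ℝ) (s : ℝ) : ℝ :=
  ∫ ω, Real.exp (-s * X ω) ∂P

end Model

end HetNet

end

/-! ### Campbell's formula and the Laplace functional of a Poisson process. -/

open MeasureTheory ProbabilityTheory

noncomputable section

namespace HetNet

open Filter Topology
open scoped NNReal ENNReal Nat

/-! Write the interference as the sum over points of `q(y) * g`, with `q` the path loss cut off at
the exclusion radius. Given the positions, the Gamma gains integrate out and turn `exp(-s q g)` into
`(1 + s q)^(-Ψ)` (`integral_exp_neg_sum_mul_gamma`). This factor is `exp(-v)` with `v = Ψ log(1 + s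
q)`, so what remains is a Laplace functional of the positions; it splits over the independent tiers,
and `laplace_functional` evaluates each part as `exp(-lam ∫ (1 - (1 + s q)^(-Ψ)))`.

In polar coordinates this exponent is a radial integral. The substitution `t = 1 / (1 + c ρ^(-α))`,
`c = s p`, together with the binomial expansion of `1 - t^Ψ`, turns it into the sum of incomplete
Beta integrals (`integral_radial`, `integral_one_sub_eq_coeffC`).

Almost sure convergence follows from Campbell's formula (`lintegral_tsum_comp`): the expected
interference is finite because `α > 2` and the gains have finite mean. -/

theorem lintegral_natCast_poissonMeasure (μ : ℝ≥0) :
    ∫⁻ n : ℕ, (n : ℝ≥0∞) ∂(poissonMeasure μ) = μ := by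
  have h1 : ∑' n : ℕ, poissonMeasure μ {n} = 1 := by
    simpa [lintegral_countable'] using lintegral_one (μ := poissonMeasure μ)
  rw [lintegral_countable', tsum_eq_zero_add' ENNReal.summable]
  have h2 : ∀ n : ℕ, ((n + 1 : ℕ) : ℝ≥0∞) * poissonMeasure μ {n + 1} =
      μ * poissonMeasure μ {n} := fun n => by
    rw [poissonMeasure_singleton, poissonMeasure_singleton, ← ENNReal.ofReal_coe_nnreal,
      ← ENNReal.ofReal_natCast, ← ENNReal.ofReal_mul (by positivity),
      ← ENNReal.ofReal_mul (by positivity)]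
    congr 1
    rw [Nat.factorial_succ]
    push_cast
    field_simp
    ring
  simp_rw [h2]
  rw [ENNReal.tsum_mul_left, h1]
  simp

theorem integral_exp_neg_mul_poissonMeasure (μ : ℝ≥0) (c : ℝ) :
    ∫ n : ℕ, Real.exp (-(c * n)) ∂(poissonMeasure μ) =
      Real.exp (-(μ * (1 - Real.exp (-c)))) := by
  rw [integral_poissonMeasure]
  have h : ∀ n : ℕ, (Real.exp (-μ) * (μ : ℝ) ^ n / n !) • Real.exp (-(c * n)) =
      Real.exp (-μ) * ((μ * Real.exp (-c)) ^ n / n !) := fun n => by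
    rw [mul_pow, ← Real.exp_nat_mul, smul_eq_mul]
    ring_nf
  simp_rw [h]
  rw [tsum_mul_left, (NormedSpace.expSeries_div_hasSum_exp (μ * Real.exp (-c))).tsum_eq,
    ← Real.exp_eq_exp_ℝ, ← Real.exp_add]
  ring_nf

section PointProcess

variable {Ω : Type*} [MeasurableSpace Ω] {P : Measure Ω} {x : ℕ → Ω → Plane} {lam : ℝ}

namespace IsHomogeneousPPP

theorem lintegral_count (h : IsHomogeneousPPP x lam P) {A : Set Plane}
    (hA : MeasurableSet A) (hA' : volume A ≠ ⊤) :
    ∫⁻ ω, count x A ω ∂P = ENNReal.ofReal lam * volume A := by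
  have hl := h.hasLaw_count A hA hA'
  have h1 : ∫⁻ ω, count x A ω ∂P = ∫⁻ z, z ∂(P.map (count x A)) :=
    (lintegral_map' aemeasurable_id hl.aemeasurable).symm
  rw [h1, hl.map_eq, lintegral_map (f := fun z => z) measurable_id .of_discrete]
  rw [lintegral_natCast_poissonMeasure]
  change ENNReal.ofReal _ = _
  rw [ENNReal.ofReal_mul' ENNReal.toReal_nonneg, ENNReal.ofReal_toReal hA']

/-- Mean counts determine the intensity measure on sets of finite area, and σ-finiteness of Lebesgue
measure extends this to all sets. As an identity of measures, it gives Campbell's formula for every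
measurable integrand at once. -/
theorem sum_map_eq (h : IsHomogeneousPPP x lam P) :
    Measure.sum (fun n => P.map (x n)) = ENNReal.ofReal lam • (volume : Measure Plane) := by
  refine (Measure.ext_iff_of_iUnion_eq_univ
    (iUnion_spanningSets (volume : Measure Plane))).2 fun i => ?_
  ext A hA
  rw [Measure.restrict_apply hA, Measure.restrict_apply hA]
  set S := A ∩ spanningSets (volume : Measure Plane) i
  have hS : MeasurableSet S := hA.inter (measurableSet_spanningSets _ i)
  have hS' : volume S ≠ ⊤ :=
    ((measure_mono Set.inter_subset_right).trans_lt (measure_spanningSets_lt_top _ i)).ne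
  rw [Measure.sum_apply _ hS, Measure.smul_apply, smul_eq_mul, ← h.lintegral_count hS hS']
  have hm : ∀ n, AEMeasurable (fun ω => S.indicator (fun _ => (1 : ℝ≥0∞)) (x n ω)) P := fun n =>
    ((measurable_const.indicator hS).comp (h.measurable n)).aemeasurable
  unfold count
  rw [lintegral_tsum hm]
  refine tsum_congr fun n => ?_
  rw [Measure.map_apply (h.measurable n) hS,
    ← lintegral_indicator_one ((h.measurable n) hS)]
  rfl

theorem lintegral_tsum_comp (h : IsHomogeneousPPP x lam P) {f : Plane → ℝ≥0∞}
    (hf : Measurable f) :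
    ∫⁻ ω, ∑' n, f (x n ω) ∂P = ENNReal.ofReal lam * ∫⁻ y, f y := by
  have hm : ∀ n, AEMeasurable (fun ω => f (x n ω)) P := fun n =>
    (hf.comp (h.measurable n)).aemeasurable
  rw [lintegral_tsum hm, ← smul_eq_mul,
    ← lintegral_smul_measure, ← h.sum_map_eq, lintegral_sum_measure]
  exact tsum_congr fun n => (lintegral_map hf (h.measurable n)).symm

theorem ae_tsum_comp_lt_top (h : IsHomogeneousPPP x lam P) {f : Plane → ℝ≥0∞}
    (hf : Measurable f) (hf' : ∫⁻ y, f y ≠ ⊤) : ∀ᵐ ω ∂P, ∑' n, f (x n ω) < ⊤ := by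
  refine ae_lt_top (Measurable.tsum fun n => hf.comp (h.measurable n)) ?_
  rw [h.lintegral_tsum_comp hf]
  exact ENNReal.mul_ne_top ENNReal.ofReal_ne_top hf'

theorem integral_exp_neg_mul_count (h : IsHomogeneousPPP x lam P) (hlam : 0 ≤ lam)
    {A : Set Plane} (hA : MeasurableSet A) (hA' : volume A ≠ ⊤) (c : ℝ) :
    ∫ ω, Real.exp (-(c * (count x A ω).toReal)) ∂P =
      Real.exp (-(lam * (volume A).toReal * (1 - Real.exp (-c)))) := by
  have hl := h.hasLaw_count A hA hA'
  have hm : Measurable fun z : ℝ≥0∞ => Real.exp (-(c * z.toReal)) := by fun_prop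
  have h1 : ∫ ω, Real.exp (-(c * (count x A ω).toReal)) ∂P =
      ∫ z, Real.exp (-(c * z.toReal)) ∂(P.map (count x A)) :=
    (integral_map hl.aemeasurable hm.aestronglyMeasurable).symm
  rw [h1, hl.map_eq, integral_map .of_discrete hm.aestronglyMeasurable]
  simp only [ENNReal.toReal_natCast]
  rw [integral_exp_neg_mul_poissonMeasure, Real.coe_toNNReal _ (by positivity)]

theorem integral_exp_neg_sum_mul_count (h : IsHomogeneousPPP x lam P) (hlam : 0 ≤ lam)
    {ι : Type*} (s : Finset ι) (A : ι → Set Plane) (hA : ∀ i, MeasurableSet (A i))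
    (hA' : ∀ i ∈ s, volume (A i) ≠ ⊤) (hd : Pairwise fun i j => Disjoint (A i) (A j))
    (c : ι → ℝ) :
    ∫ ω, Real.exp (-∑ i ∈ s, c i * (count x (A i) ω).toReal) ∂P =
      Real.exp (-∑ i ∈ s, lam * (volume (A i)).toReal * (1 - Real.exp (-c i))) := by
  let e := s.equivFin.symm
  have hi := h.indep_count s.card (fun k => A (e k)) (fun k => hA _)
    (fun k => hA' _ (e k).2)
    (fun i j hij => hd fun hh => hij (e.injective (Subtype.ext hh)))
  have hsum : ∀ F : ι → ℝ, ∑ i ∈ s, F i = ∑ k, F (e k) := fun F => by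
    rw [← Finset.sum_coe_sort, ← e.sum_comp]
  simp_rw [hsum, ← Finset.sum_neg_distrib, Real.exp_sum]
  have hm : ∀ k, Measurable fun z : ℝ≥0∞ => Real.exp (-(c (e k) * z.toReal)) :=
    fun k => by fun_prop
  rw [hi.integral_fun_prod_comp
    (fun k => (h.hasLaw_count _ (hA _) (hA' _ (e k).2)).aemeasurable)
    (f := fun k z => Real.exp (-(c (e k) * z.toReal)))
    (fun k => (hm k).aestronglyMeasurable)]
  exact Finset.prod_congr rfl fun k _ =>
    h.integral_exp_neg_mul_count hlam (hA _) (hA' _ (e k).2) _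

/-- The sum over the points is a linear combination of the counts in the level sets of `F`, which
are disjoint and hence have independent Poisson counts. The value `0` is discarded: it contributes
nothing, and its level set has infinite area. -/
theorem laplace_simpleFunc (h : IsHomogeneousPPP x lam P) (hlam : 0 ≤ lam)
    (F : SimpleFunc Plane ℝ≥0∞) (hF : ∀ y, F y < ⊤) (hF' : volume (Function.support F) < ⊤) :
    ∫ ω, Real.exp (-(∑' n, F (x n ω)).toReal) ∂P =
      Real.exp (-(lam * ∫ y, (1 - Real.exp (-(F y).toReal)))) := by
  classical
  set s := F.range.filter (· ≠ 0) with hs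
  let A : ℝ≥0∞ → Set Plane := fun c => F ⁻¹' {c}
  have hA : ∀ c, MeasurableSet (A c) := fun c => F.measurableSet_fiber c
  have hs0 : ∀ c ∈ s, c ≠ 0 := fun c hc => (Finset.mem_filter.1 hc).2
  have hs_top : ∀ c ∈ s, c ≠ ⊤ := fun c hc => by
    obtain ⟨y, rfl⟩ := SimpleFunc.mem_range.1 (Finset.mem_filter.1 hc).1
    exact (hF y).ne
  have hA' : ∀ c ∈ s, volume (A c) ≠ ⊤ := fun c hc =>
    ((measure_mono fun y (hy : F y = c) => by
      simpa [Function.mem_support, hy] using hs0 c hc).trans_lt hF').ne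
  have hd : Pairwise fun c d => Disjoint (A c) (A d) := fun c d hcd =>
    Set.disjoint_left.2 fun y (hc : F y = c) (hd : F y = d) => hcd (hc ▸ hd)
  -- The codomain is general because this decomposition serves twice: for `F` itself in `ℝ≥0∞`, and
  -- for `1 - exp(-F)` in `ℝ`.
  have key : ∀ (M : Type) [AddCommMonoid M] (θ : ℝ≥0∞ → M), θ 0 = 0 → ∀ y,
      θ (F y) = ∑ c ∈ s, (A c).indicator (fun _ => θ c) y := fun M _ θ h0 y => by
    by_cases hy : F y = 0
    · rw [hy, h0, Finset.sum_eq_zero]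
      exact fun c hc => Set.indicator_of_notMem (fun (hc' : F y = c) => hs0 c hc (hc' ▸ hy)) _
    · rw [Finset.sum_eq_single (F y)]
      · exact (Set.indicator_of_mem (show y ∈ A (F y) from rfl) (fun _ => θ (F y))).symm
      · exact fun c _ hc => Set.indicator_of_notMem (fun (hc' : F y = c) => hc hc'.symm) _
      · exact fun hc => absurd (Finset.mem_filter.2 ⟨SimpleFunc.mem_range_self F y, hy⟩) hc
  have hsum : ∀ ω, ∑' n, F (x n ω) = ∑ c ∈ s, c * count x (A c) ω := fun ω => by
    rw [tsum_congr fun n => key ℝ≥0∞ (fun c => c) rfl (x n ω)]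
    rw [Summable.tsum_finsetSum fun _ _ => ENNReal.summable]
    refine Finset.sum_congr rfl fun c _ => ?_
    rw [count, ← ENNReal.tsum_mul_left]
    refine tsum_congr fun n => ?_
    by_cases hn : x n ω ∈ A c <;> simp [hn]
  have hfin : ∀ᵐ ω ∂P, ∀ c ∈ s, count x (A c) ω < ⊤ := by
    refine (ae_ball_iff s.countable_toSet).2 fun c hc =>
      h.ae_tsum_comp_lt_top (measurable_const.indicator (hA c)) ?_
    rw [lintegral_indicator_const (hA c), one_mul]
    exact hA' c hc
  have hL : ∫ ω, Real.exp (-(∑' n, F (x n ω)).toReal) ∂P =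
      ∫ ω, Real.exp (-∑ c ∈ s, c.toReal * (count x (A c) ω).toReal) ∂P := by
    refine integral_congr_ae ?_
    filter_upwards [hfin] with ω hω
    rw [hsum, ENNReal.toReal_sum fun c hc => ENNReal.mul_ne_top (hs_top c hc) (hω c hc).ne]
    simp_rw [ENNReal.toReal_mul]
  have hR : ∫ y, (1 - Real.exp (-(F y).toReal)) =
      ∑ c ∈ s, (volume (A c)).toReal * (1 - Real.exp (-c.toReal)) := by
    simp_rw [key ℝ (fun c => 1 - Real.exp (-c.toReal)) (by simp)]
    rw [integral_finsetSum]
    · refine Finset.sum_congr rfl fun c _ => ?_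
      rw [integral_indicator_const _ (hA c), smul_eq_mul]
      rfl
    · exact fun c hc => (integrable_indicator_iff (hA c)).2 (integrableOn_const (hA' c hc))
  rw [hL, hR, h.integral_exp_neg_sum_mul_count hlam s A hA hA' hd, Finset.mul_sum]
  simp_rw [mul_assoc]

/-- The Laplace functional of a homogeneous Poisson point process. -/
theorem laplace_functional [IsProbabilityMeasure P] (h : IsHomogeneousPPP x lam P)
    (hlam : 0 ≤ lam) {f : Plane → ℝ≥0∞} (hf : Measurable f) (hf' : ∫⁻ y, f y ≠ ⊤) :
    ∫ ω, Real.exp (-(∑' n, f (x n ω)).toReal) ∂P =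
      Real.exp (-(lam * ∫ y, (1 - Real.exp (-(f y).toReal)))) := by
  let F := SimpleFunc.eapprox f
  have hFf : ∀ k y, F k y ≤ f y := fun k y => by
    rw [← SimpleFunc.iSup_eapprox_apply hf y]
    exact le_iSup (fun k => F k y) k
  have hmono : ∀ y, Monotone fun k => F k y := fun y i j hij =>
    SimpleFunc.monotone_eapprox f hij y
  have hL : Tendsto (fun k => ∫ ω, Real.exp (-(∑' n, F k (x n ω)).toReal) ∂P) atTop
      (𝓝 (∫ ω, Real.exp (-(∑' n, f (x n ω)).toReal) ∂P)) := by
    refine tendsto_integral_of_dominated_convergence (fun _ => 1) (fun k => ?_)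
      (integrable_const _) (fun k => ae_of_all _ fun ω => ?_) ?_
    · have : Measurable fun ω => ∑' n, F k (x n ω) :=
        Measurable.tsum fun n => (F k).measurable.comp (h.measurable n)
      exact (by fun_prop : Measurable fun ω =>
        Real.exp (-(∑' n, F k (x n ω)).toReal)).aestronglyMeasurable
    · simp
    · filter_upwards [h.ae_tsum_comp_lt_top hf hf'] with ω hω
      have ht : Tendsto (fun k => ∑' n, F k (x n ω)) atTop (𝓝 (∑' n, f (x n ω))) := by
        -- Series are read as integrals against counting measure, so that monotone convergence
        -- applies.
        simp_rw [← MeasureTheory.lintegral_count]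
        exact lintegral_tendsto_of_tendsto_of_monotone (fun _ => .of_discrete)
          (ae_of_all _ fun n => hmono _)
          (ae_of_all _ fun n => SimpleFunc.tendsto_eapprox hf _)
      exact ((ENNReal.tendsto_toReal hω.ne).comp ht).neg.rexp
  have hR : Tendsto (fun k => ∫ y, (1 - Real.exp (-(F k y).toReal))) atTop
      (𝓝 (∫ y, (1 - Real.exp (-(f y).toReal)))) := by
    have hfin : ∀ᵐ y, f y < ⊤ := ae_lt_top hf hf'
    -- The domination is `1 - exp(-z) ≤ z` combined with `F k ≤ f`.
    refine tendsto_integral_of_dominated_convergence (fun y => (f y).toReal) (fun k => ?_)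
      (integrable_toReal_of_lintegral_ne_top hf.aemeasurable hf') (fun k => ?_) ?_
    · have := (F k).measurable
      exact (by fun_prop : Measurable fun y =>
        1 - Real.exp (-(F k y).toReal)).aestronglyMeasurable
    · filter_upwards [hfin] with y hy
      have h1 : (F k y).toReal ≤ (f y).toReal := ENNReal.toReal_mono hy.ne (hFf k y)
      have h2 : 0 ≤ (F k y).toReal := ENNReal.toReal_nonneg
      have h3 : Real.exp (-(F k y).toReal) ≤ 1 := Real.exp_le_one_iff.2 (by linarith)
      have h4 := Real.add_one_le_exp (-(F k y).toReal)
      rw [Real.norm_of_nonneg (by linarith)]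
      linarith
    · filter_upwards [hfin] with y hy
      exact (((ENNReal.tendsto_toReal hy.ne).comp
        (SimpleFunc.tendsto_eapprox hf y)).neg.rexp).const_sub 1
  refine tendsto_nhds_unique hL ?_
  have hk : ∀ k, ∫ ω, Real.exp (-(∑' n, F k (x n ω)).toReal) ∂P =
      Real.exp (-(lam * ∫ y, (1 - Real.exp (-(F k y).toReal)))) := fun k =>
    h.laplace_simpleFunc hlam (F k) (SimpleFunc.eapprox_lt_top f k)
      (measure_support_eapprox_lt_top hf hf' k)
  simp_rw [hk]
  exact (hR.const_mul lam).neg.rexp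

end IsHomogeneousPPP

end PointProcess

end HetNet

/-! ### The radial integral and incomplete Beta functions. -/

namespace HetNet

open Filter Topology Set

theorem one_sub_pow_eq_sum_Icc (n : ℕ) (t : ℝ) :
    1 - t ^ n = ∑ i ∈ Finset.Icc 1 n, (n.choose i : ℝ) * (t ^ (n - i) * (1 - t) ^ i) := by
  have h := add_pow (1 - t) t n
  rw [sub_add_cancel, one_pow, Finset.range_eq_Ico, Finset.sum_eq_sum_Ico_succ_bot (by omega)] at h
  have h2 : Finset.Icc 1 n = Finset.Ico (0 + 1) (n + 1) := by ext; simp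
  rw [h2]
  simp only [pow_zero, Nat.sub_zero, Nat.choose_zero_right, Nat.cast_one, one_mul, mul_one] at h
  refine sub_eq_iff_eq_add'.2 (h.trans ?_)
  congr 1
  exact Finset.sum_congr rfl fun i _ => by ring

/-- Only the endpoint `1` can be singular, since `w > 0` keeps `t` away from `0`; hence `a` is
unrestricted. -/
theorem intervalIntegrable_compBeta {a b w : ℝ} (hb : 0 < b) (hw : 0 < w) (hw1 : w < 1) :
    IntervalIntegrable (fun t : ℝ => t ^ (a - 1) * (1 - t) ^ (b - 1)) volume w 1 := by
  have h1 : IntervalIntegrable (fun t : ℝ => (1 - t) ^ (b - 1)) volume w 1 := by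
    have h := (intervalIntegral.intervalIntegrable_rpow' (a := 1 - w) (b := 0)
      (by linarith : -1 < b - 1)).comp_sub_left 1
    simpa using h
  refine h1.continuousOn_mul ?_
  refine ContinuousOn.rpow_const continuousOn_id fun t ht => Or.inl ?_
  rw [uIcc_of_le hw1.le] at ht
  exact (hw.trans_le ht.1).ne'

/-- Expanding `((1 - t) + t)^n` without its `i = 0` term gives `1 - t^n`. The terms are separately
integrable because `i ≥ 1 > 2 / α`; the missing term would diverge at `1`. -/
theorem sum_choose_mul_compBeta {α w : ℝ} (hα : 2 < α) (n : ℕ) (hw : 0 < w) (hw1 : w < 1) :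
    ∑ i ∈ Finset.Icc 1 n,
      (n.choose i : ℝ) * compBeta ((n : ℝ) - (i : ℝ) + 2 / α) ((i : ℝ) - 2 / α) w =
    ∫ t in Ioo w 1, (1 - t ^ n) * (t ^ (2 / α - 1) * (1 - t) ^ (-(2 / α) - 1)) := by
  have hα2 : 2 / α < 1 := by rw [div_lt_one (by linarith)]; exact hα
  have hi : ∀ i ∈ Finset.Icc 1 n, IntervalIntegrable
      (fun t : ℝ => (n.choose i : ℝ) * (t ^ ((n : ℝ) - i + 2 / α - 1) *
        (1 - t) ^ ((i : ℝ) - 2 / α - 1))) volume w 1 := fun i hi => by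
    have : (1 : ℝ) ≤ i := by exact_mod_cast (Finset.mem_Icc.1 hi).1
    exact (intervalIntegrable_compBeta (by linarith) hw hw1).const_mul _
  simp_rw [compBeta, ← intervalIntegral.integral_const_mul]
  rw [← intervalIntegral.integral_finsetSum hi, intervalIntegral.integral_of_le hw1.le,
    integral_Ioc_eq_integral_Ioo]
  refine setIntegral_congr_fun measurableSet_Ioo fun t ht => ?_
  have ht0 : 0 < t := hw.trans ht.1
  have ht1 : 0 < 1 - t := by linarith [ht.2]
  rw [one_sub_pow_eq_sum_Icc, Finset.sum_mul]
  refine Finset.sum_congr rfl fun i hi => ?_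
  have hin := (Finset.mem_Icc.1 hi).2
  rw [show (n : ℝ) - i + 2 / α - 1 = ((n - i : ℕ) : ℝ) + (2 / α - 1) by
      push_cast [hin]; ring, show (i : ℝ) - 2 / α - 1 = (i : ℝ) + (-(2 / α) - 1) by ring,
    Real.rpow_add ht0, Real.rpow_add ht1, Real.rpow_natCast, Real.rpow_natCast]
  ring

/-- The map `u ρ = 1 / (1 + c ρ^(-α))` increases from `u R` to `1` on `(R, ∞)`, and changing
variables along it produces the Beta integrand. -/
theorem integral_radial {α c R : ℝ} (hα : 2 < α) (hc : 0 < c) (hR : 0 < R) (n : ℕ) :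
    ∫ ρ in Ioi R, ρ * (1 - (1 / (1 + c * ρ ^ (-α))) ^ n) =
      c ^ (2 / α) / α * ∑ i ∈ Finset.Icc 1 n, (n.choose i : ℝ) *
        compBeta ((n : ℝ) - (i : ℝ) + 2 / α) ((i : ℝ) - 2 / α) (1 / (1 + c * R ^ (-α))) := by
  have hα0 : 0 < α := by linarith
  let u : ℝ → ℝ := fun ρ => 1 / (1 + c * ρ ^ (-α))
  let u' : ℝ → ℝ := fun ρ => c * α * ρ ^ (-α - 1) / (1 + c * ρ ^ (-α)) ^ 2
  have hpos : ∀ ρ, 0 < ρ → 0 < c * ρ ^ (-α) := fun ρ hρ =>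
    mul_pos hc (Real.rpow_pos_of_pos hρ _)
  have hu0 : ∀ ρ, 0 < ρ → 0 < u ρ := fun ρ hρ =>
    one_div_pos.2 (by linarith [hpos ρ hρ])
  have hu1 : ∀ ρ, 0 < ρ → u ρ < 1 := fun ρ hρ => by
    have := hpos ρ hρ
    rw [div_lt_one (by linarith)]; linarith
  have hanti : ∀ a b, 0 < a → a < b → u a < u b := fun a b ha hab =>
    one_div_lt_one_div_of_lt (by linarith [hpos b (ha.trans hab)])
      (by
        have := Real.rpow_lt_rpow_of_neg ha hab (by linarith : -α < 0)
        nlinarith)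
  have hder : ∀ ρ ∈ Ioi R, HasDerivWithinAt u (u' ρ) (Ioi R) ρ := fun ρ hρ => by
    have hρ0 : 0 < ρ := hR.trans hρ
    have h1 := (((Real.hasDerivAt_rpow_const (p := -α) (Or.inl hρ0.ne')).const_mul c).const_add
      1).inv (by linarith [hpos ρ hρ0])
    have h2 : HasDerivAt u (u' ρ) ρ := by
      have hu : u = (fun x => 1 + c * x ^ (-α))⁻¹ := by funext z; simp [u]
      rw [hu]
      exact h1.congr_deriv (by simp only [u']; ring)
    exact h2.hasDerivWithinAt
  have hinj : InjOn u (Ioi R) := by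
    have : StrictMonoOn u (Ioi R) := fun a ha b _ hab => hanti a b (hR.trans ha) hab
    exact this.injOn
  have himg : u '' Ioi R = Ioo (u R) 1 := by
    ext t
    constructor
    · rintro ⟨ρ, hρ, rfl⟩
      exact ⟨hanti R ρ hR hρ, hu1 ρ (hR.trans hρ)⟩
    · rintro ⟨h1, h2⟩
      have ht0 : 0 < t := (hu0 R hR).trans h1
      have h1t : 0 < 1 - t := by linarith
      -- The solution of `u ρ = t`, that is, of `ρ^(-α) = (1 - t) / (c t)`.
      let ρ := ((1 - t) / (c * t)) ^ (-α)⁻¹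
      have hb : 0 < (1 - t) / (c * t) := by positivity
      have hρ0 : 0 < ρ := Real.rpow_pos_of_pos hb _
      have hρ : u ρ = t := by
        simp only [u, ρ]
        rw [Real.rpow_inv_rpow hb.le (by linarith)]
        field_simp
        ring
      refine ⟨ρ, ?_, hρ⟩
      by_contra hle
      rcases (not_lt.1 (show ¬ R < ρ from hle)).lt_or_eq with h | h
      · have := hanti ρ R hρ0 h
        linarith
      · rw [h] at hρ; linarith
  rw [sum_choose_mul_compBeta hα n (hu0 R hR) (hu1 R hR)]
  change _ = c ^ (2 / α) / α * ∫ t in Ioo (u R) 1, _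
  rw [← himg, integral_image_eq_integral_abs_deriv_smul measurableSet_Ioi hder hinj,
    ← integral_const_mul]
  refine setIntegral_congr_fun measurableSet_Ioi fun ρ hρ => ?_
  have hρ0 : 0 < ρ := hR.trans hρ
  have hq := hpos ρ hρ0
  have hu'0 : 0 ≤ u' ρ := by
    have := Real.rpow_pos_of_pos hρ0 (-α - 1)
    simp only [u']; positivity
  -- This removes `1 - u`, so the integrand becomes powers of `c`, `u ρ` and `ρ`, which `e2`, `e3`
  -- and `e4` collect separately.
  have h1u : 1 - u ρ = c * ρ ^ (-α) * u ρ := by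
    simp only [u]
    field_simp
    ring
  have hup := hu0 ρ hρ0
  simp only [smul_eq_mul, abs_of_nonneg hu'0]
  change ρ * (1 - u ρ ^ n) = _
  rw [h1u, Real.mul_rpow hq.le hup.le, Real.mul_rpow hc.le (Real.rpow_nonneg hρ0.le _),
    ← Real.rpow_mul hρ0.le]
  have e1 : u' ρ = c * α * ρ ^ (-α - 1) * u ρ ^ (2 : ℝ) := by
    rw [Real.rpow_two]
    simp only [u', u]
    field_simp
  have e2 : c ^ (2 / α) * c * c ^ (-(2 / α) - 1) = 1 := by
    rw [← Real.rpow_add_one hc.ne', ← Real.rpow_add hc]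
    ring_nf
    exact Real.rpow_zero _
  have e3 : u ρ ^ (2 : ℝ) * u ρ ^ (2 / α - 1) * u ρ ^ (-(2 / α) - 1) = 1 := by
    rw [← Real.rpow_add hup, ← Real.rpow_add hup]
    ring_nf
    exact Real.rpow_zero _
  have e4 : ρ ^ (-α - 1) * ρ ^ (-α * (-(2 / α) - 1)) = ρ := by
    rw [← Real.rpow_add hρ0]
    have : -α - 1 + -α * (-(2 / α) - 1) = 1 := by field_simp; ring
    rw [this, Real.rpow_one]
  rw [e1]
  calc ρ * (1 - u ρ ^ n)
      = (1 - u ρ ^ n) * (c ^ (2 / α) * c * c ^ (-(2 / α) - 1)) *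
        (u ρ ^ (2 : ℝ) * u ρ ^ (2 / α - 1) * u ρ ^ (-(2 / α) - 1)) *
        (ρ ^ (-α - 1) * ρ ^ (-α * (-(2 / α) - 1))) := by rw [e2, e3, e4]; ring
    _ = _ := by field_simp

/-- The Laplace exponent of the interference outside a ball around the origin. -/
theorem integral_one_sub_eq_coeffC {α c R : ℝ} (hα : 2 < α) (hc : 0 < c) (hR : 0 < R) (n : ℕ) :
    ∫ y : Plane, {y : Plane | R < ‖y‖}.indicator
        (fun y => 1 - (1 / (1 + c * ‖y‖ ^ (-α))) ^ n) y =
      c ^ (2 / α) * coeffC α n (1 / (1 + c * R ^ (-α))) := by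
  let f : ℝ → ℝ := (Ioi R).indicator fun ρ => 1 - (1 / (1 + c * ρ ^ (-α))) ^ n
  have h1 : ∀ y : Plane, {y : Plane | R < ‖y‖}.indicator
      (fun y => 1 - (1 / (1 + c * ‖y‖ ^ (-α))) ^ n) y = f ‖y‖ := fun y => rfl
  simp_rw [h1]
  have hball : (volume : Measure Plane).real (Metric.ball 0 1) = Real.pi := by
    simp [Measure.real, EuclideanSpace.volume_ball_fin_two, Real.pi_nonneg]
  rw [integral_fun_norm_addHaar volume f, hball]
  have h2 : ∫ ρ in Ioi (0 : ℝ), ρ ^ (Module.finrank ℝ Plane - 1) • f ρ =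
      ∫ ρ in Ioi R, ρ * (1 - (1 / (1 + c * ρ ^ (-α))) ^ n) := by
    have h3 : ∀ ρ : ℝ, ρ ^ (Module.finrank ℝ Plane - 1) • f ρ =
        (Ioi R).indicator (fun ρ => ρ * (1 - (1 / (1 + c * ρ ^ (-α))) ^ n)) ρ := fun ρ => by
      by_cases h : ρ ∈ Ioi R <;> simp [f, h]
    simp_rw [h3]
    rw [setIntegral_indicator measurableSet_Ioi,
      inter_eq_self_of_subset_right (Ioi_subset_Ioi hR.le)]
  rw [h2, integral_radial hα hc hR, coeffC]
  simp only [finrank_euclideanSpace_fin, smul_eq_mul, nsmul_eq_mul]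
  push_cast
  ring

end HetNet

/-! ### Gamma gains and integrability of the path loss. -/

namespace HetNet

open Filter Topology
open scoped ENNReal

section Gains

/-- Exponential tilting of a Gamma density only changes its rate, from `1` to `1 + t`, at the cost
of the factor `(1 + t)^(-a)`. Negative `t` is admitted for the moment bound that follows. -/
theorem lintegral_exp_neg_mul_gammaMeasure {a t : ℝ} (ha : 0 < a) (ht : -1 < t) :
    ∫⁻ z, ENNReal.ofReal (Real.exp (-(t * z))) ∂(gammaMeasure a 1) =
      ENNReal.ofReal ((1 + t) ^ (-a)) := by
  have ht1 : 0 < 1 + t := by linarith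
  have hm : Measurable (gammaPDF a 1) := (measurable_gammaPDFReal a 1).ennreal_ofReal
  rw [gammaMeasure, lintegral_withDensity_eq_lintegral_mul _ hm (by fun_prop)]
  have h : ∀ z, (gammaPDF a 1 * fun z => ENNReal.ofReal (Real.exp (-(t * z)))) z =
      ENNReal.ofReal ((1 + t) ^ (-a)) * gammaPDF a (1 + t) z := fun z => by
    rcases lt_or_ge z 0 with hz | hz
    · simp [gammaPDF_of_neg hz]
    · rw [Pi.mul_apply, gammaPDF_of_nonneg hz, gammaPDF_of_nonneg hz,
        ← ENNReal.ofReal_mul (by have := Real.Gamma_pos_of_pos ha; positivity),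
        ← ENNReal.ofReal_mul (by positivity)]
      congr 1
      rw [show -((1 + t) * z) = -(1 * z) + -(t * z) by ring, Real.exp_add, Real.one_rpow,
        Real.rpow_neg ht1.le]
      have : (1 + t) ^ a ≠ 0 := (Real.rpow_pos_of_pos ht1 a).ne'
      field_simp
  simp_rw [h]
  have hm' : Measurable (gammaPDF a (1 + t)) := (measurable_gammaPDFReal a _).ennreal_ofReal
  rw [lintegral_const_mul _ hm', lintegral_gammaPDF_eq_one ha ht1, mul_one]

theorem ae_nonneg_gammaMeasure (a : ℝ) : ∀ᵐ z ∂(gammaMeasure a 1), 0 ≤ z := by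
  rw [ae_iff]
  have h : {z : ℝ | ¬ 0 ≤ z} = Set.Iio 0 := by ext; simp
  rw [h, gammaMeasure, withDensity_apply _ measurableSet_Iio, lintegral_gammaPDF_of_nonpos le_rfl]

theorem lintegral_ofReal_gammaMeasure_lt_top {a : ℝ} (ha : 0 < a) :
    ∫⁻ z, ENNReal.ofReal z ∂(gammaMeasure a 1) < ⊤ := by
  calc ∫⁻ z, ENNReal.ofReal z ∂(gammaMeasure a 1)
      -- From `z ≤ 2 exp(z / 2)`; the exponential moment is the case `t = -1/2`.
      ≤ ∫⁻ z, ENNReal.ofReal 2 * ENNReal.ofReal (Real.exp (-(-(1 / 2) * z)))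
          ∂(gammaMeasure a 1) := by
        refine lintegral_mono fun z => ?_
        rw [← ENNReal.ofReal_mul zero_le_two]
        refine ENNReal.ofReal_le_ofReal ?_
        have := Real.add_one_le_exp (-(-(1 / 2) * z))
        linarith
    _ < ⊤ := by
        rw [lintegral_const_mul _ (by fun_prop),
          lintegral_exp_neg_mul_gammaMeasure ha (by norm_num)]
        exact ENNReal.mul_lt_top ENNReal.ofReal_lt_top ENNReal.ofReal_lt_top

variable {Ω : Type*} [MeasurableSpace Ω] {P : Measure Ω}

theorem lintegral_exp_neg_sum_mul_gamma {ι : Type*} {G : ι → Ω → ℝ} {a : ι → ℝ}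
    (ha : ∀ i, 0 < a i) (hG : ∀ i, Measurable (G i))
    (hlaw : ∀ i, HasLaw (G i) (gammaMeasure (a i) 1) P) (hi : iIndepFun G P)
    (s : Finset ι) {c : ι → ℝ} (hc : ∀ i, 0 ≤ c i) :
    ∫⁻ ω, ENNReal.ofReal (Real.exp (-∑ i ∈ s, c i * G i ω)) ∂P =
      ENNReal.ofReal (∏ i ∈ s, (1 + c i) ^ (-a i)) := by
  have hm : ∀ i, Measurable fun z : ℝ => ENNReal.ofReal (Real.exp (-(c i * z))) :=
    fun i => by fun_prop
  have hi' := hi.comp _ hm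
  simp_rw [← Finset.sum_neg_distrib, Real.exp_sum,
    ENNReal.ofReal_prod_of_nonneg fun i _ => (Real.exp_pos _).le]
  rw [ENNReal.ofReal_prod_of_nonneg fun i _ => Real.rpow_nonneg (by linarith [hc i]) _]
  refine (lintegral_prod_eq_prod_lintegral_of_indepFun s _ hi'
    fun i => (hm i).comp (hG i)).trans (Finset.prod_congr rfl fun i _ => ?_)
  rw [← lintegral_exp_neg_mul_gammaMeasure (ha i) (by linarith [hc i]), ← (hlaw i).map_eq,
    lintegral_map (hm i) (hG i)]
  rfl

/-- Integrating out independent Gamma gains, conditionally on the positions `Y`. -/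
theorem integral_exp_neg_sum_mul_gamma [IsProbabilityMeasure P] {ι E : Type*} [MeasurableSpace E] {Y : Ω → E}
    {G : ι → Ω → ℝ} {a : ι → ℝ} (ha : ∀ i, 0 < a i) (hG : ∀ i, Measurable (G i))
    (hlaw : ∀ i, HasLaw (G i) (gammaMeasure (a i) 1) P) (hi : iIndepFun G P)
    (hY : Measurable Y) (hYG : IndepFun Y (fun ω i => G i ω) P) (s : Finset ι)
    {c : ι → E → ℝ} (hc : ∀ i y, 0 ≤ c i y) (hcm : ∀ i, Measurable (c i)) :
    ∫ ω, Real.exp (-∑ i ∈ s, c i (Y ω) * G i ω) ∂P =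
      ∫ ω, ∏ i ∈ s, (1 + c i (Y ω)) ^ (-a i) ∂P := by
  have hGm : Measurable fun ω i => G i ω := measurable_pi_lambda _ hG
  have hm : Measurable fun z : E × (ι → ℝ) =>
      ENNReal.ofReal (Real.exp (-∑ i ∈ s, c i z.1 * z.2 i)) := by fun_prop
  have hm2 : Measurable fun y : E => ∏ i ∈ s, (1 + c i y) ^ (-a i) := by fun_prop
  rw [integral_eq_lintegral_of_nonneg_ae (ae_of_all _ fun ω => (Real.exp_pos _).le)
      (by fun_prop),
    integral_eq_lintegral_of_nonneg_ae (ae_of_all _ fun ω => Finset.prod_nonneg fun i _ =>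
      Real.rpow_nonneg (by linarith [hc i (Y ω)]) _) (hm2.comp hY).aestronglyMeasurable]
  congr 1
  have h1 : ∫⁻ ω, ENNReal.ofReal (Real.exp (-∑ i ∈ s, c i (Y ω) * G i ω)) ∂P =
      ∫⁻ z, ENNReal.ofReal (Real.exp (-∑ i ∈ s, c i z.1 * z.2 i))
        ∂(P.map fun ω => (Y ω, fun i => G i ω)) := by
    rw [lintegral_map hm (hY.prodMk hGm)]
  have : IsProbabilityMeasure (P.map fun ω i => G i ω) :=
    Measure.isProbabilityMeasure_map hGm.aemeasurable
  -- Independence makes the joint law a product, so Tonelli lets the gains be integrated with the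
  -- positions frozen.
  rw [h1, hYG.map_prod_eq_prod_map_map hY.aemeasurable hGm.aemeasurable,
    lintegral_prod _ hm.aemeasurable, lintegral_map hm.lintegral_prod_right' hY]
  refine lintegral_congr fun ω => ?_
  refine (lintegral_map (hm.comp (measurable_prodMk_left (x := Y ω))) hGm).trans ?_
  exact lintegral_exp_neg_sum_mul_gamma ha hG hlaw hi s fun i => hc i (Y ω)

end Gains

section PathLoss

/-- The received power `p ‖y‖^{-α}` at unit gain from a BS at `y` outside the ball of radius `R`. -/
def pathLoss (α p R : ℝ) (y : Plane) : ℝ :=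
  {y : Plane | R < ‖y‖}.indicator (fun y => p * ‖y‖ ^ (-α)) y

variable {α p R : ℝ}

theorem measurableSet_lt_norm (R : ℝ) : MeasurableSet {y : Plane | R < ‖y‖} :=
  measurableSet_lt measurable_const measurable_norm

theorem measurable_pathLoss : Measurable (pathLoss α p R) := by
  have : Measurable fun y : Plane => p * ‖y‖ ^ (-α) := by fun_prop
  exact this.indicator (measurableSet_lt_norm R)

theorem pathLoss_nonneg (hp : 0 ≤ p) (y : Plane) : 0 ≤ pathLoss α p R y :=
  Set.indicator_nonneg (fun y _ => by positivity) y

theorem lintegral_pathLoss_ne_top (hα : 2 < α) (hp : 0 ≤ p) (hR : 0 < R) :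
    ∫⁻ y, ENNReal.ofReal (pathLoss α p R y) ≠ ⊤ := by
  -- For `‖y‖ > R`, `(1 + ‖y‖) / ‖y‖ ≤ (1 + R) / R`; the majorant is integrable because `α` exceeds
  -- the dimension.
  have hint : Integrable (fun y : Plane => p * ((1 + R) / R) ^ α * (1 + ‖y‖) ^ (-α)) :=
    (integrable_one_add_norm (by simpa using hα)).const_mul _
  refine ((lintegral_mono fun y => ENNReal.ofReal_le_ofReal ?_).trans_lt
    hint.lintegral_lt_top).ne
  rw [pathLoss]
  refine Set.indicator_apply_le' (fun hy => ?_) (fun _ => by positivity)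
  have hy' : R < ‖y‖ := hy
  have hy0 : 0 < ‖y‖ := hR.trans hy'
  rw [mul_assoc]
  refine mul_le_mul_of_nonneg_left ?_ hp
  rw [Real.rpow_neg hy0.le, Real.rpow_neg (by positivity), ← div_eq_mul_inv,
    ← Real.div_rpow (by positivity) (by positivity), ← Real.inv_rpow hy0.le]
  refine Real.rpow_le_rpow (by positivity) ?_ (by linarith)
  rw [inv_eq_one_div, div_div, div_le_div_iff₀ hy0 (by positivity)]
  nlinarith

theorem integral_one_sub_pathLoss {s : ℝ} (hα : 2 < α) (hp : 0 < p) (hR : 0 < R) (hs : 0 < s)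
    (n : ℕ) :
    ∫ y, (1 - (1 + s * pathLoss α p R y) ^ (-(n : ℝ))) =
      (s * p) ^ (2 / α) * coeffC α n (1 / (1 + s * p * R ^ (-α))) := by
  rw [← integral_one_sub_eq_coeffC hα (mul_pos hs hp) hR]
  refine integral_congr_ae (ae_of_all _ fun y => ?_)
  by_cases hy : y ∈ {y : Plane | R < ‖y‖}
  · simp only [pathLoss, Set.indicator_of_mem hy]
    rw [Real.rpow_neg (by positivity), Real.rpow_natCast, ← mul_assoc]
    simp
  · simp [pathLoss, Set.indicator_of_notMem hy]

end PathLoss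

theorem tendsto_sum_range_toReal_tsum {h : ℕ → ℝ} (h0 : ∀ n, 0 ≤ h n)
    (hfin : ∑' n, ENNReal.ofReal (h n) ≠ ⊤) :
    Tendsto (fun n => ∑ i ∈ Finset.range n, h i) atTop
      (𝓝 (∑' n, ENNReal.ofReal (h n)).toReal) := by
  have hs := (ENNReal.hasSum_toReal hfin).tendsto_sum_nat
  rw [← ENNReal.tsum_toReal_eq (ENNReal.ne_top_of_tsum_ne_top hfin)] at hs
  simpa only [ENNReal.toReal_ofReal (h0 _)] using hs

instance : Fintype Tier := ⟨⟨{.mbs, .sbs}, by simp⟩, by rintro (_ | _) <;> simp⟩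

theorem sum_tier {M : Type*} [AddCommMonoid M] (F : Tier → M) :
    ∑ j, F j = F .mbs + F .sbs := by
  change (Multiset.map F {.mbs, .sbs}).sum = _
  simp

end HetNet

/-! ### Assembly for the two-tier model. -/

namespace HetNet

open Filter Topology
open scoped ENNReal

theorem Network.exclusionRadius_pos (N : Network) (k j : Tier) {r : ℝ} (hr : 0 < r) :
    0 < N.exclusionRadius k r j := by
  have hb := N.biasRatio_pos
  cases k <;> cases j <;> simp only [exclusionRadius] <;> positivity

/-- In each case the quantity multiplying `s * p` is the exclusion radius to the power `-α`. Thus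
the association enters only through that radius, and both cases share one proof. -/
theorem Network.w_eq (N : Network) (k j : Tier) {r : ℝ} (hr : 0 < r) (s : ℝ) :
    N.w k s r j = 1 / (1 + s * N.p j * N.exclusionRadius k r j ^ (-N.α)) := by
  have hb := N.biasRatio_pos
  have hα : N.α ≠ 0 := by linarith [N.two_lt_α]
  have key : ∀ z : ℝ, 0 < z → (z ^ (1 / N.α)) ^ (-N.α) = z⁻¹ := fun z hz => by
    rw [← Real.rpow_mul hz.le, ← Real.rpow_neg_one]
    congr 1
    field_simp
  cases k <;> cases j <;> simp only [w, exclusionRadius]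
  · rw [key _ (by positivity), one_div (N.biasRatio * _)]
  · rw [key _ (by positivity)]

theorem interferenceTerm_eq {Ω : Type*} {N : Network} {x : Tier → ℕ → Ω → Plane}
    {g : Tier → ℕ → Ω → ℝ} (k : Tier) (r : ℝ) (j : Tier) (n : ℕ) (ω : Ω) :
    interferenceTerm N x g k r j n ω =
      pathLoss N.α (N.p j) (N.exclusionRadius k r j) (x j n ω) * g j n ω := by
  by_cases h : x j n ω ∈ {y : Plane | N.exclusionRadius k r j < ‖y‖}
  · simp only [interferenceTerm, pathLoss, Set.indicator_of_mem h]
    ring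
  · simp [interferenceTerm, pathLoss, Set.indicator_of_notMem h]

section Model

variable {Ω : Type*} [MeasurableSpace Ω] {P : Measure Ω} {N : Network}
  {x : Tier → ℕ → Ω → Plane} {g : Tier → ℕ → Ω → ℝ}

namespace IsModel

theorem ae_gain_nonneg (hm : IsModel N x g P) : ∀ᵐ ω ∂P, ∀ j n, 0 ≤ g j n ω := by
  refine ae_all_iff.2 fun j => ae_all_iff.2 fun n => ?_
  have h := ae_nonneg_gammaMeasure (N.Ψ j)
  rw [← (hm.hasLaw_gain j n).map_eq] at h
  exact ae_of_ae_map (hm.measurable_gain j n).aemeasurable h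

theorem ae_summable_interferenceTerm (hm : IsModel N x g P) (k : Tier) {r : ℝ} (hr : 0 < r) :
    ∀ᵐ ω ∂P, ∀ j, Summable fun n => interferenceTerm N x g k r j n ω := by
  refine ae_all_iff.2 fun j => ?_
  set q := pathLoss N.α (N.p j) (N.exclusionRadius k r j) with hq
  have hΨ : (0 : ℝ) < N.Ψ j := by exact_mod_cast N.Ψ_pos j
  have hqm : Measurable fun y => ENNReal.ofReal (q y) := measurable_pathLoss.ennreal_ofReal
  have hq0 : ∀ y, 0 ≤ q y := pathLoss_nonneg (N.p_pos j).le
  have hxm := (hm.ppp j).measurable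
  have hgm := hm.measurable_gain j
  have hterm : ∀ n, ∫⁻ ω, ENNReal.ofReal (q (x j n ω)) * ENNReal.ofReal (g j n ω) ∂P =
      (∫⁻ ω, ENNReal.ofReal (q (x j n ω)) ∂P) *
        ∫⁻ z, ENNReal.ofReal z ∂(gammaMeasure (N.Ψ j) 1) := fun n => by
    have hind : IndepFun (fun ω => ENNReal.ofReal (q (x j n ω)))
        (fun ω => ENNReal.ofReal (g j n ω)) P :=
      hm.indep_positions_gains.comp (hqm.comp (measurable_pi_apply (j, n)))
        (ENNReal.measurable_ofReal.comp (measurable_pi_apply (j, n)))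
    rw [← (hm.hasLaw_gain j n).map_eq, lintegral_map ENNReal.measurable_ofReal (hgm n)]
    exact lintegral_mul_eq_lintegral_mul_lintegral_of_indepFun (hqm.comp (hxm n))
      (hgm n).ennreal_ofReal hind
  have hmm : ∀ n, Measurable fun ω => ENNReal.ofReal (q (x j n ω)) * ENNReal.ofReal (g j n ω) :=
    fun n => (hqm.comp (hxm n)).mul (hgm n).ennreal_ofReal
  have hfin : ∫⁻ ω, ∑' n, ENNReal.ofReal (q (x j n ω)) * ENNReal.ofReal (g j n ω) ∂P ≠ ⊤ := by
    rw [lintegral_tsum fun n => (hmm n).aemeasurable]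
    simp_rw [hterm]
    have hxq : ∀ n, AEMeasurable (fun ω => ENNReal.ofReal (q (x j n ω))) P := fun n =>
      (hqm.comp (hxm n)).aemeasurable
    rw [ENNReal.tsum_mul_right, ← lintegral_tsum hxq, (hm.ppp j).lintegral_tsum_comp hqm]
    exact ENNReal.mul_ne_top (ENNReal.mul_ne_top ENNReal.ofReal_ne_top
      (lintegral_pathLoss_ne_top N.two_lt_α (N.p_pos j).le (N.exclusionRadius_pos k j hr)))
      (lintegral_ofReal_gammaMeasure_lt_top hΨ).ne
  filter_upwards [ae_lt_top (Measurable.tsum hmm) hfin, hm.ae_gain_nonneg] with ω hω hg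
  refine (ENNReal.summable_toReal hω.ne).congr fun n => ?_
  rw [ENNReal.toReal_mul, ENNReal.toReal_ofReal (hq0 _), ENNReal.toReal_ofReal (hg j n),
    interferenceTerm_eq]

/-- The Laplace transform of the interference power at a positive argument. -/
theorem laplaceTransform_interference [IsProbabilityMeasure P] (hm : IsModel N x g P) (k : Tier)
    {r s : ℝ} (hr : 0 < r) (hs : 0 < s) :
    laplaceTransform P (interference N x g k r) s =
      ∏ j, Real.exp (-(N.lam j * ((s * N.p j) ^ (2 / N.α) *
        coeffC N.α (N.Ψ j) (N.w k s r j)))) := by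
  let q : Tier → Plane → ℝ := fun j => pathLoss N.α (N.p j) (N.exclusionRadius k r j)
  have hq0 : ∀ j y, 0 ≤ s * q j y := fun j y =>
    mul_nonneg hs.le (pathLoss_nonneg (N.p_pos j).le y)
  have hqm : ∀ j, Measurable (q j) := fun j => measurable_pathLoss
  -- Chosen so that `exp(-v)` is the factor left after averaging one gain; `log(1 + z) ≤ z` then
  -- makes `v` integrable.
  let v : Tier → Plane → ℝ := fun j y => N.Ψ j * Real.log (1 + s * q j y)
  have hv0 : ∀ j y, 0 ≤ v j y := fun j y =>
    mul_nonneg (Nat.cast_nonneg _) (Real.log_nonneg (by linarith [hq0 j y]))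
  have hvm : ∀ j, Measurable (v j) := fun j => by
    have := hqm j
    fun_prop
  have hvE : ∀ j, Measurable fun y => ENNReal.ofReal (v j y) := fun j => (hvm j).ennreal_ofReal
  have hvexp : ∀ j y, Real.exp (-v j y) = (1 + s * q j y) ^ (-(N.Ψ j : ℝ)) := fun j y => by
    rw [Real.rpow_def_of_pos (by linarith [hq0 j y])]
    congr 1
    simp only [v]; ring
  have hvfin : ∀ j, ∫⁻ y, ENNReal.ofReal (v j y) ≠ ⊤ := fun j => by
    have h1 : ∀ y, ENNReal.ofReal (v j y) ≤
        ENNReal.ofReal (N.Ψ j * s) * ENNReal.ofReal (q j y) := fun y => by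
      rw [← ENNReal.ofReal_mul (by positivity), mul_assoc]
      refine ENNReal.ofReal_le_ofReal (mul_le_mul_of_nonneg_left ?_ (Nat.cast_nonneg _))
      linarith [Real.log_le_sub_one_of_pos (by linarith [hq0 j y] : 0 < 1 + s * q j y)]
    refine ((lintegral_mono h1).trans_lt ?_).ne
    rw [lintegral_const_mul _ (hqm j).ennreal_ofReal]
    exact ENNReal.mul_lt_top ENNReal.ofReal_lt_top
      (lintegral_pathLoss_ne_top N.two_lt_α (N.p_pos j).le (N.exclusionRadius_pos k j hr)).lt_top
  have hfun : ∀ j, ∫ ω, Real.exp (-(∑' n, ENNReal.ofReal (v j (x j n ω))).toReal) ∂P =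
      Real.exp (-(N.lam j * ((s * N.p j) ^ (2 / N.α) *
        coeffC N.α (N.Ψ j) (N.w k s r j)))) := fun j => by
    rw [(hm.ppp j).laplace_functional (N.lam_pos j).le (hvE j) (hvfin j)]
    simp_rw [ENNReal.toReal_ofReal (hv0 j _), hvexp]
    rw [integral_one_sub_pathLoss N.two_lt_α (N.p_pos j) (N.exclusionRadius_pos k j hr) hs,
      N.w_eq k j hr]
  have hxm : ∀ j n, Measurable (x j n) := fun j => (hm.ppp j).measurable
  have hgm := hm.measurable_gain
  -- The gains are integrated out over finitely many points; both sides then pass to the limit,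
  -- dominated by `1`.
  let A : ℕ → Finset (Tier × ℕ) := fun n => Finset.univ ×ˢ Finset.range n
  have hpartial : ∀ n, ∫ ω, Real.exp (-∑ a ∈ A n, s * q a.1 (x a.1 a.2 ω) * g a.1 a.2 ω) ∂P =
      ∫ ω, Real.exp (-∑ a ∈ A n, v a.1 (x a.1 a.2 ω)) ∂P := fun n => by
    simp_rw [← Finset.sum_neg_distrib (f := fun a : Tier × ℕ => v a.1 (x a.1 a.2 _)),
      Real.exp_sum, hvexp]
    exact integral_exp_neg_sum_mul_gamma (Y := fun ω (a : Tier × ℕ) => x a.1 a.2 ω)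
      (G := fun a ω => g a.1 a.2 ω) (a := fun a => (N.Ψ a.1 : ℝ))
      (fun a => by exact_mod_cast N.Ψ_pos a.1) (fun a => hgm a.1 a.2)
      (fun a => hm.hasLaw_gain a.1 a.2) hm.indep_gains
      (measurable_pi_lambda _ fun a => hxm a.1 a.2) hm.indep_positions_gains (A n)
      (c := fun a y => s * q a.1 (y a)) (fun a y => hq0 a.1 (y a))
      (fun a => ((hqm a.1).comp (measurable_pi_apply a)).const_mul s)
  have hsumA : ∀ (n : ℕ) (F : Tier × ℕ → ℝ),
      ∑ a ∈ A n, F a = ∑ j, ∑ i ∈ Finset.range n, F (j, i) := fun n F =>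
    Finset.sum_product _ _ _
  have hleft : Tendsto
      (fun n => ∫ ω, Real.exp (-∑ a ∈ A n, s * q a.1 (x a.1 a.2 ω) * g a.1 a.2 ω) ∂P) atTop
      (𝓝 (laplaceTransform P (interference N x g k r) s)) := by
    refine tendsto_integral_of_dominated_convergence (fun _ => 1)
      (fun n => Measurable.aestronglyMeasurable ?_) (integrable_const _) (fun n => ?_) ?_
    · have h1 : ∀ a : Tier × ℕ, Measurable fun ω => q a.1 (x a.1 a.2 ω) := fun a =>
        (hqm a.1).comp (hxm a.1 a.2)
      have h2 : ∀ a : Tier × ℕ, Measurable fun ω => g a.1 a.2 ω := fun a => hgm a.1 a.2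
      fun_prop
    · filter_upwards [hm.ae_gain_nonneg] with ω hg
      rw [Real.norm_of_nonneg (Real.exp_pos _).le, Real.exp_le_one_iff, neg_nonpos]
      exact Finset.sum_nonneg fun a _ => mul_nonneg (hq0 _ _) (hg _ _)
    · filter_upwards [hm.ae_summable_interferenceTerm k hr] with ω hω
      have h1 : ∀ n, ∑ a ∈ A n, s * q a.1 (x a.1 a.2 ω) * g a.1 a.2 ω =
          s * ∑ j, ∑ i ∈ Finset.range n, interferenceTerm N x g k r j i ω := fun n => by
        simp_rw [hsumA, interferenceTerm_eq, Finset.mul_sum, mul_assoc]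
        rfl
      simp_rw [h1, neg_mul]
      rw [interference, ← sum_tier fun j => ∑' n, interferenceTerm N x g k r j n ω]
      exact ((tendsto_finsetSum _ fun j _ =>
        (hω j).hasSum.tendsto_sum_nat).const_mul s).neg.rexp
  have hright : Tendsto (fun n => ∫ ω, Real.exp (-∑ a ∈ A n, v a.1 (x a.1 a.2 ω)) ∂P) atTop
      (𝓝 (∫ ω, Real.exp (-∑ j, (∑' n, ENNReal.ofReal (v j (x j n ω))).toReal) ∂P)) := by
    refine tendsto_integral_of_dominated_convergence (fun _ => 1)
      (fun n => Measurable.aestronglyMeasurable ?_) (integrable_const _)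
      (fun n => ae_of_all _ fun ω => ?_) ?_
    · have h1 : ∀ a : Tier × ℕ, Measurable fun ω => v a.1 (x a.1 a.2 ω) := fun a =>
        (hvm a.1).comp (hxm a.1 a.2)
      fun_prop
    · rw [Real.norm_of_nonneg (Real.exp_pos _).le, Real.exp_le_one_iff, neg_nonpos]
      exact Finset.sum_nonneg fun a _ => hv0 _ _
    · have hfin : ∀ᵐ ω ∂P, ∀ j, ∑' n, ENNReal.ofReal (v j (x j n ω)) < ⊤ :=
        ae_all_iff.2 fun j => (hm.ppp j).ae_tsum_comp_lt_top (hvE j) (hvfin j)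
      filter_upwards [hfin] with ω hω
      simp_rw [hsumA]
      exact (tendsto_finsetSum _ fun j _ => tendsto_sum_range_toReal_tsum
        (fun n => hv0 j (x j n ω)) (hω j).ne).neg.rexp
  have heq := tendsto_nhds_unique hleft (by simpa only [hpartial] using hright)
  have hprod : ∀ F : Tier → ℝ, ∏ j, F j = F .mbs * F .sbs :=
    fun F => sum_tier (M := Additive ℝ) F
  -- Independence of the tiers is between whole position sequences, so each factor is viewed as a
  -- functional of a sequence.
  have hΞ : ∀ j, Measurable fun y : ℕ → Plane =>
      Real.exp (-(∑' n, ENNReal.ofReal (v j (y n))).toReal) := fun j => by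
    have : Measurable fun y : ℕ → Plane => ∑' n, ENNReal.ofReal (v j (y n)) :=
      Measurable.tsum fun n => (hvE j).comp (measurable_pi_apply n)
    fun_prop
  rw [heq, hprod, ← hfun, ← hfun]
  simp_rw [sum_tier, neg_add, Real.exp_add]
  exact hm.indep_tiers.integral_fun_comp_mul_comp
    (measurable_pi_lambda _ (hxm .mbs)).aemeasurable
    (measurable_pi_lambda _ (hxm .sbs)).aemeasurable
    (hΞ .mbs).aestronglyMeasurable (hΞ .sbs).aestronglyMeasurable

end IsModel

end Model

end HetNet

end

theorem mainTheorem3 {Ω : Type*} [MeasurableSpace Ω] (P : MeasureTheory.Measure Ω)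
    [MeasureTheory.IsProbabilityMeasure P] (N : HetNet.Network)
    (x : HetNet.Tier → ℕ → Ω → HetNet.Plane) (g : HetNet.Tier → ℕ → Ω → ℝ)
    (hmodel : HetNet.IsModel N x g P) (k : HetNet.Tier) (r : ℝ) (hr : 0 < r) :
    (∀ᵐ ω ∂P, ∀ j, Summable (fun n => HetNet.interferenceTerm N x g k r j n ω)) ∧
    ∀ s : ℝ, 0 ≤ s →
      HetNet.laplaceTransform P (HetNet.interference N x g k r) s =
        Real.exp (-(s ^ (2 / N.α)) *
          (N.lam .mbs * N.p .mbs ^ (2 / N.α) *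
              HetNet.coeffC N.α (N.Ψ .mbs) (N.w k s r .mbs) +
            N.lam .sbs * N.p .sbs ^ (2 / N.α) *
              HetNet.coeffC N.α (N.Ψ .sbs) (N.w k s r .sbs))) := by
  refine ⟨hmodel.ae_summable_interferenceTerm k hr, fun s hs => ?_⟩
  -- The substitution needs `c = s p > 0`; at `s = 0` both sides equal `1`.
  rcases hs.eq_or_lt with rfl | hs0
  · have hα : 2 / N.α ≠ 0 := by
      have := N.two_lt_α
      positivity
    simp [HetNet.laplaceTransform, Real.zero_rpow hα]
  · rw [hmodel.laplaceTransform_interference k hr hs0, ← Real.exp_sum, HetNet.sum_tier]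
    congr 1
    rw [Real.mul_rpow hs (N.p_pos _).le, Real.mul_rpow hs (N.p_pos _).le]
    ring
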